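/- Let $(\Omega,\mathcal F,(\mathcal F_t)_{t\ge 0},P)$ be a filtered probability space with right-continuous filtration. All processes are real-valued, adapted and càdlàg. A process $X$ is a local martingale if there are stopping times $\tau_n$ increasing to $\infty$ almost surely such that every stopped process $X^{\tau_n}=X_{\tau_n\wedge\,\cdot}$ is a uniformly integrable martingale (in particular $X_0$ is integrable), and $\mathcal H^1$ denotes the class of local martingales $X$ with $E(\sup_{t\ge0}|X_t|)<\infty$. Let $M$ be a non-negative local martingale that is not a uniformly integrable martingale, and set $$c_n=\ln\Bigl(e+\sum_{k=1}^n P\bigl(\sup_{t\ge0}|M_t|>k\bigr)\Bigr),\qquad n\ge 1.$$ Then $c_n>1$ for all $n\ge1$, the sequence $(c_n)$ is non-decreasing, and $c_n\to\infty$. Moreover, let $Y$ be any $\mathcal F_0$-measurable random variable with values in the natural numbers that is independent of the process $M$ and satisfies $P(Y>n)=1/c_n$ for every $n\ge1$, and let $$\sigma=\inf\{t\ge0 : |M_t|>Y\}\qquad(\inf\emptyset=\infty).$$ Then $\sigma$ is a stopping time, and the stopped process $M^\sigma=M_{\sigma\wedge\,\cdot}$ is a uniformly integrable martingale that does not belong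 to $\mathcal H^1$; that is, $E(\sup_{t\ge0}|M^\sigma_t|)=\infty$. -/

import Mathlib

open MeasureTheory ProbabilityTheory Filter Topology
open scoped NNReal ENNReal

noncomputable section

namespace WeakTail

/-- Every path of `X` is right-continuous with (finite) left limits. -/
def IsCadlag {Ω : Type*} (X : ℝ≥0 → Ω → ℝ) : Prop :=
  ∀ ω t, ContinuousWithinAt (fun s => X s ω) (Set.Ici t) t ∧
    ∃ l : ℝ, Tendsto (fun s => X s ω) (𝓝[<] t) (𝓝 l)

/-- The class of (càdlàg) uniformly integrable martingales. -/
structure IsUIMartingale {Ω : Type*} {m : MeasurableSpace Ω} (X : ℝ≥0 → Ω → ℝ)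
    (𝓕 : Filtration ℝ≥0 m) (P : Measure Ω) : Prop where
  cadlag : IsCadlag X
  martingale : Martingale X 𝓕 P
  uniformIntegrable : UniformIntegrable X 1 P

/-- The class of (càdlàg, adapted) local martingales: there are stopping times increasing almost
surely to infinity such that every stopped process is a uniformly integrable martingale.
As time zero is not treated separately, `X 0` is integrable. -/
structure IsLocalMartingale {Ω : Type*} {m : MeasurableSpace Ω} (X : ℝ≥0 → Ω → ℝ)
    (𝓕 : Filtration ℝ≥0 m) (P : Measure Ω) : Prop where
  cadlag : IsCadlag X
  adapted : StronglyAdapted 𝓕 X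
  localized : ∃ τ : ℕ → Ω → WithTop ℝ≥0, IsLocalizingSequence 𝓕 τ P ∧
    ∀ n, IsUIMartingale (stoppedProcess X (τ n)) 𝓕 P

/-- The maximal variable `sup_{t ≥ 0} |X_t|`, with values in `[0, ∞]`. -/
def supAbs {Ω : Type*} (X : ℝ≥0 → Ω → ℝ) (ω : Ω) : ℝ≥0∞ :=
  ⨆ t, ‖X t ω‖ₑ

/-- The class `H¹` of local martingales whose maximal variable is integrable. -/
structure IsH1 {Ω : Type*} {m : MeasurableSpace Ω} (X : ℝ≥0 → Ω → ℝ)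
    (𝓕 : Filtration ℝ≥0 m) (P : Measure Ω) : Prop where
  localMartingale : IsLocalMartingale X 𝓕 P
  integrable_sup : ∫⁻ ω, supAbs X ω ∂P < ∞

/-- `c_n = ln (e + ∑_{k=1}^n P(sup_{t ≥ 0} |X_t| > k))`. -/
def tailSeq {Ω : Type*} {m : MeasurableSpace Ω} (X : ℝ≥0 → Ω → ℝ) (P : Measure Ω) (n : ℕ) : ℝ :=
  Real.log (Real.exp 1 + ∑ k ∈ Finset.Icc 1 n, P.real {ω | (k : ℝ≥0∞) < supAbs X ω})

/-- The first time `inf {t ≥ 0 | |X_t| > Y}` at which `|X|` exceeds the random level `Y`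
(it is `⊤` if this never happens). -/
def firstExceed {Ω : Type*} (X : ℝ≥0 → Ω → ℝ) (Y : Ω → ℕ) (ω : Ω) : WithTop ℝ≥0 :=
  hittingAfter X {x : ℝ | (Y ω : ℝ) < |x|} 0 ω

end WeakTail

end

/-! Write `S_n = ∑_{k≤n} P(sup |M| > k)`, so that `c_n = ln (e + S_n)`. A local martingale with
integrable maximal variable is uniformly integrable by domination, so here `E sup |M| = ∞`, hence
`S_n → ∞` and `c_n → ∞`.

`M^σ` is a uniformly integrable martingale: up to `σ` the path is bounded by `Y + |M_σ|`, with
`|M_σ|` read as `terminalAbs`, which is integrable by Fatou and the supermartingale bound. On `{Y ≤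
N}` this dominates by an integrable variable. Off it, since `{Y > N}` lies in `𝓕 0`, the mass of
`M^σ_t` is at most `E(M_0; Y > N)`, which tends to `0` uniformly in `t`
(`isUIMartingale_stoppedProcess_firstExceed`).

Its maximal variable is at least `min (sup |M|) Y`. By independence and monotonicity of `c`, its
mean is at least `∑_{k≤n} P(sup |M| > k) / c_k ≥ S_n / c_n`, which diverges because `c_n` is only
logarithmic in `S_n` (`lintegral_supAbs_stoppedProcess_eq_top`). -/

namespace WeakTail

variable {Ω : Type*} {m : MeasurableSpace Ω} {P : Measure Ω} {𝓕 : Filtration ℝ≥0 m}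
  {X M : ℝ≥0 → Ω → ℝ} {τ σ : Ω → WithTop ℝ≥0} {Y : Ω → ℕ}

/-! ### Dense times and stopped càdlàg paths. -/

lemma exists_denseSeq_between {f : ℝ≥0 → ℝ} {t v : ℝ≥0}
    (hf : ContinuousWithinAt f (Set.Ici t) t) {U : Set ℝ} (hU : IsOpen U) (ht : f t ∈ U)
    (htv : t < v) :
    ∃ n, TopologicalSpace.denseSeq ℝ≥0 n < v ∧ f (TopologicalSpace.denseSeq ℝ≥0 n) ∈ U := by
  have h : ∀ᶠ s in 𝓝[>] t, f s ∈ U :=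
    (hf.eventually (hU.mem_nhds ht)).filter_mono (nhdsWithin_mono _ Set.Ioi_subset_Ici_self)
  obtain ⟨u, hu, hsub⟩ := (mem_nhdsGT_iff_exists_Ioo_subset' htv).1 h
  obtain ⟨n, hn⟩ := (TopologicalSpace.denseRange_denseSeq ℝ≥0).exists_mem_open
    (isOpen_Ioo (a := t) (b := min u v)) (Set.nonempty_Ioo.2 (lt_min hu htv))
  exact ⟨n, hn.2.trans_le (min_le_right _ _), hsub ⟨hn.1, hn.2.trans_le (min_le_left _ _)⟩⟩

/-- The stopped time `t ∧ τ` as a finite time. -/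
noncomputable def minTime (τ : Ω → WithTop ℝ≥0) (t : ℝ≥0) (ω : Ω) : ℝ≥0 :=
  (min (t : WithTop ℝ≥0) (τ ω)).untopA

lemma coe_minTime (τ : Ω → WithTop ℝ≥0) (t : ℝ≥0) (ω : Ω) :
    (minTime τ t ω : WithTop ℝ≥0) = min (t : WithTop ℝ≥0) (τ ω) := by
  have h : min (t : WithTop ℝ≥0) (τ ω) ≠ ⊤ :=
    ne_top_of_le_ne_top WithTop.coe_ne_top (min_le_left _ _)
  rw [minTime, WithTop.untopA_eq_untop h, WithTop.coe_untop]

lemma minTime_le (τ : Ω → WithTop ℝ≥0) (t : ℝ≥0) (ω : Ω) : minTime τ t ω ≤ t := by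
  rw [← WithTop.coe_le_coe, coe_minTime]
  exact min_le_left _ _

lemma stoppedProcess_apply (X : ℝ≥0 → Ω → ℝ) (τ : Ω → WithTop ℝ≥0) (t : ℝ≥0) (ω : Ω) :
    stoppedProcess X τ t ω = X (minTime τ t ω) ω := rfl

lemma minTime_of_eq_top {t : ℝ≥0} {ω : Ω} (h : τ ω = ⊤) : minTime τ t ω = t := by
  rw [← WithTop.coe_inj, coe_minTime, h, min_eq_left le_top]

lemma minTime_of_eq_coe {t s : ℝ≥0} {ω : Ω} (h : τ ω = s) : minTime τ t ω = min t s := by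
  rw [← WithTop.coe_inj, coe_minTime, h, WithTop.coe_min]

lemma minTime_zero (τ : Ω → WithTop ℝ≥0) (ω : Ω) : minTime τ 0 ω = 0 :=
  le_antisymm (minTime_le τ 0 ω) zero_le

lemma measurable_minTime (hτ : IsStoppingTime 𝓕 τ) (t : ℝ≥0) :
    Measurable[𝓕 t] (minTime τ t) := by
  let _ : MeasurableSpace Ω := 𝓕 t
  refine measurable_of_Iio fun c => ?_
  have h : minTime τ t ⁻¹' Set.Iio c = {ω | t < c ∨ τ ω < c} := by
    ext ω
    simp only [Set.mem_preimage, Set.mem_Iio, Set.mem_ofPred_eq]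
    rw [← WithTop.coe_lt_coe, coe_minTime, min_lt_iff, WithTop.coe_lt_coe]
  rw [h]
  by_cases htc : t < c
  · simp [htc]
  · simpa [htc] using 𝓕.mono (not_lt.1 htc) _ (hτ.measurableSet_lt c)

lemma IsCadlag.stoppedProcess (hX : IsCadlag X) (τ : Ω → WithTop ℝ≥0) :
    IsCadlag (stoppedProcess X τ) := by
  intro ω t
  simp only [stoppedProcess_apply]
  obtain h | ⟨s, hs⟩ : τ ω = ⊤ ∨ ∃ s : ℝ≥0, τ ω = s := by
    cases h : τ ω with
    | top => exact Or.inl rfl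
    | coe s => exact Or.inr ⟨s, rfl⟩
  · simp only [minTime_of_eq_top h]
    exact hX ω t
  · simp only [minTime_of_eq_coe hs]
    refine ⟨?_, ?_⟩
    · exact ContinuousWithinAt.comp (f := fun r => min r s) (x := t) (hX ω (min t s)).1
        (by fun_prop) fun r hr => min_le_min (Set.mem_Ici.1 hr) le_rfl
    · rcases le_or_gt t s with hts | hst
      · obtain ⟨l, hl⟩ := (hX ω t).2
        refine ⟨l, hl.congr' ?_⟩
        filter_upwards [self_mem_nhdsWithin] with r hr
        rw [min_eq_left (le_of_lt (lt_of_lt_of_le hr hts))]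
      · refine ⟨X s ω, tendsto_const_nhds.congr' ?_⟩
        filter_upwards [mem_nhdsWithin_of_mem_nhds (lt_mem_nhds hst)] with r hr
        rw [min_eq_right hr.le]

/-! ### Optional stopping in continuous time by grid approximation. -/

/-- The approximation from above, by the grid of mesh `1 / (j + 1)`, of the time `t ∧ τ`. -/
noncomputable def gridTime (τ : Ω → WithTop ℝ≥0) (t : ℝ≥0) (j : ℕ) (ω : Ω) : ℝ≥0 :=
  min t ((⌊minTime τ t ω * (j + 1)⌋₊ + 1) / (j + 1))

lemma gridTime_le (τ : Ω → WithTop ℝ≥0) (t : ℝ≥0) (j : ℕ) (ω : Ω) : gridTime τ t j ω ≤ t :=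
  min_le_left _ _

lemma minTime_le_gridTime (τ : Ω → WithTop ℝ≥0) (t : ℝ≥0) (j : ℕ) (ω : Ω) :
    minTime τ t ω ≤ gridTime τ t j ω := by
  refine le_min (minTime_le _ _ _) ?_
  rw [le_div_iff₀ (by positivity)]
  exact (Nat.lt_floor_add_one _).le

lemma gridTime_le_add (τ : Ω → WithTop ℝ≥0) (t : ℝ≥0) (j : ℕ) (ω : Ω) :
    gridTime τ t j ω ≤ minTime τ t ω + 1 / (j + 1) := by
  refine (min_le_right _ _).trans ?_
  have h := Nat.floor_le (zero_le : 0 ≤ minTime τ t ω * (j + 1))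
  rw [add_div]
  gcongr
  rwa [div_le_iff₀ (by positivity)]

lemma tendsto_gridTime (τ : Ω → WithTop ℝ≥0) (t : ℝ≥0) (ω : Ω) :
    Tendsto (fun j => gridTime τ t j ω) atTop (𝓝[≥] minTime τ t ω) := by
  refine tendsto_nhdsWithin_iff.2 ⟨?_, Eventually.of_forall fun j => minTime_le_gridTime τ t j ω⟩
  have h : Tendsto (fun j : ℕ => minTime τ t ω + 1 / ((j : ℝ≥0) + 1)) atTop
      (𝓝 (minTime τ t ω + 0)) :=
    tendsto_const_nhds.add tendsto_one_div_add_atTop_nhds_zero_nat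
  rw [add_zero] at h
  exact tendsto_of_tendsto_of_tendsto_of_le_of_le tendsto_const_nhds h
    (fun j => minTime_le_gridTime τ t j ω) fun j => gridTime_le_add τ t j ω

lemma tendsto_gridTime_apply (hX : IsCadlag X) (τ : Ω → WithTop ℝ≥0) (t : ℝ≥0) (ω : Ω) :
    Tendsto (fun j => X (gridTime τ t j ω) ω) atTop (𝓝 (stoppedProcess X τ t ω)) :=
  (hX ω (minTime τ t ω)).1.tendsto.comp (tendsto_gridTime τ t ω)

/-- The grid point lies strictly above `t ∧ τ` before truncation at `t`. So for `i < t` it is at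
most `i` exactly when `τ` is strictly below the last grid point `q ≤ i`, an event of `𝓕 q`. -/
lemma isStoppingTime_gridTime (hτ : IsStoppingTime 𝓕 τ) (t : ℝ≥0) (j : ℕ) :
    IsStoppingTime 𝓕 (fun ω => (gridTime τ t j ω : WithTop ℝ≥0)) := by
  intro i
  rcases le_or_gt t i with hti | hit
  · have h : {ω | (gridTime τ t j ω : WithTop ℝ≥0) ≤ i} = Set.univ :=
      Set.eq_univ_of_forall fun ω => WithTop.coe_le_coe.2 ((gridTime_le τ t j ω).trans hti)
    rw [h]
    exact MeasurableSet.univ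
  · have hj : (0 : ℝ≥0) < j + 1 := by positivity
    set q : ℝ≥0 := ⌊i * (j + 1)⌋₊ / (j + 1) with hq
    have hqi : q ≤ i := by
      rw [hq, div_le_iff₀ hj]
      exact Nat.floor_le zero_le
    have h : {ω | (gridTime τ t j ω : WithTop ℝ≥0) ≤ i} = {ω | τ ω < q} := by
      ext ω
      simp only [Set.mem_ofPred_eq, WithTop.coe_le_coe]
      have h1 : gridTime τ t j ω ≤ i ↔ minTime τ t ω < q := by
        rw [gridTime, min_le_iff, or_iff_right (not_le.2 hit), div_le_iff₀ hj, hq,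
          lt_div_iff₀ hj, ← Nat.floor_lt zero_le, ← Nat.add_one_le_iff,
          Nat.le_floor_iff zero_le]
        push_cast
        rfl
      rw [h1, ← WithTop.coe_lt_coe, coe_minTime, min_lt_iff, WithTop.coe_lt_coe,
        or_iff_right (not_lt.2 (hqi.trans hit.le))]
    rw [h]
    exact 𝓕.mono hqi _ (hτ.measurableSet_lt q)

lemma countable_range_gridTime (τ : Ω → WithTop ℝ≥0) (t : ℝ≥0) (j : ℕ) :
    (Set.range fun ω => (gridTime τ t j ω : WithTop ℝ≥0)).Countable := by
  refine (Set.countable_range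
    fun n : ℕ => ((min t ((n + 1) / (j + 1)) : ℝ≥0) : WithTop ℝ≥0)).mono ?_
  rintro _ ⟨ω, rfl⟩
  exact ⟨_, rfl⟩

lemma measurable_apply_natIndex {α : Type*} {mα : MeasurableSpace α} {F : ℕ → α → ℝ}
    (hF : ∀ n, Measurable (F n)) {N : α → ℕ} (hN : Measurable N) :
    Measurable fun a => F (N a) a := by
  have h : Measurable fun p : ℕ × α => F p.1 p.2 := measurable_from_prod_countable_right hF
  exact h.comp (hN.prodMk measurable_id)

lemma measurable_gridTime_apply (hX : StronglyAdapted 𝓕 X) (hτ : IsStoppingTime 𝓕 τ)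
    (t : ℝ≥0) (j : ℕ) : Measurable[𝓕 t] (fun ω => X (gridTime τ t j ω) ω) := by
  have hN : Measurable[𝓕 t] fun ω => ⌊minTime τ t ω * (j + 1)⌋₊ :=
    Nat.measurable_floor.comp ((measurable_minTime hτ t).mul_const _)
  exact measurable_apply_natIndex (F := fun n => X (min t ((n + 1) / (j + 1))))
    (fun n => ((hX _).mono (𝓕.mono (min_le_left _ _))).measurable) hN

lemma stronglyAdapted_stoppedProcess (hc : IsCadlag X) (hX : StronglyAdapted 𝓕 X)
    (hτ : IsStoppingTime 𝓕 τ) : StronglyAdapted 𝓕 (stoppedProcess X τ) := fun t =>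
  stronglyMeasurable_of_tendsto atTop
    (fun j => (measurable_gridTime_apply hX hτ t j).stronglyMeasurable)
    (tendsto_pi_nhds.2 fun ω => tendsto_gridTime_apply hc τ t ω)

/-- Optional stopping at the bounded time `t ∧ τ`. -/
lemma integrable_integral_stoppedProcess [IsProbabilityMeasure P] (hc : IsCadlag X)
    (hX : Martingale X 𝓕 P) (hτ : IsStoppingTime 𝓕 τ) (t : ℝ≥0) :
    Integrable (stoppedProcess X τ t) P ∧ ∫ ω, stoppedProcess X τ t ω ∂P = ∫ ω, X t ω ∂P := by
  have hst := fun j => isStoppingTime_gridTime hτ t j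
  have hle : ∀ j ω, (gridTime τ t j ω : WithTop ℝ≥0) ≤ t := fun j ω =>
    WithTop.coe_le_coe.2 (gridTime_le τ t j ω)
  -- The values on the grid are conditional expectations of the single variable `X t`, hence
  -- uniformly integrable; this upgrades their pointwise convergence to convergence in `L¹`.
  have heq : ∀ j, (fun ω => X (gridTime τ t j ω) ω) =ᵐ[P] P[X t | (hst j).measurableSpace] :=
    fun j => hX.stoppedValue_ae_eq_condExp_of_le_const_of_countable_range (hst j) (hle j)
      (countable_range_gridTime τ t j)
  have hui : UniformIntegrable (fun j ω => X (gridTime τ t j ω) ω) 1 P :=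
    ((hX.integrable t).uniformIntegrable_condExp
      fun j => (hst j).measurableSpace_le_of_le (hle j)).ae_eq fun j => (heq j).symm
  have hlim : ∀ᵐ ω ∂P, Tendsto (fun j => X (gridTime τ t j ω) ω) atTop
      (𝓝 (stoppedProcess X τ t ω)) := ae_of_all _ fun ω => tendsto_gridTime_apply hc τ t ω
  have hmem : MemLp (stoppedProcess X τ t) 1 P := hui.memLp_of_ae_tendsto hlim
  have hint := tendsto_integral_of_L1' _ hmem.1
    (Eventually.of_forall fun j => memLp_one_iff_integrable.1 (hui.memLp j))
    (tendsto_Lp_finite_of_tendsto_ae le_rfl ENNReal.one_ne_top hui.1 hmem hui.2.1 hlim)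
  refine ⟨memLp_one_iff_integrable.1 hmem, tendsto_nhds_unique hint ?_⟩
  refine tendsto_const_nhds.congr fun j => ?_
  rw [integral_congr_ae (heq j), integral_condExp]

/-- Test time for the martingale property: comparing its mean value with that at `s ∧ τ` isolates
the integral over `A`. -/
lemma isStoppingTime_switch (hτ : IsStoppingTime 𝓕 τ) {s t : ℝ≥0} (hst : s ≤ t) {A : Set Ω}
    (hA : MeasurableSet[𝓕 s] A) [DecidablePred (· ∈ A)] :
    IsStoppingTime 𝓕 (fun ω =>
      if ω ∈ A then min (t : WithTop ℝ≥0) (τ ω) else min (s : WithTop ℝ≥0) (τ ω)) := by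
  intro i
  rcases lt_or_ge i s with his | hsi
  · convert hτ i using 1
    ext ω
    have h1 : ¬ t ≤ i := not_le.2 (his.trans_le hst)
    have h2 : ¬ s ≤ i := not_le.2 his
    simp only [Set.mem_ofPred_eq]
    split_ifs
    · rw [min_le_iff, WithTop.coe_le_coe, or_iff_right h1]
    · rw [min_le_iff, WithTop.coe_le_coe, or_iff_right h2]
  · have h : {ω | (if ω ∈ A then min (t : WithTop ℝ≥0) (τ ω) else min (s : WithTop ℝ≥0) (τ ω)) ≤ i}
        = {ω | min (t : WithTop ℝ≥0) (τ ω) ≤ i} ∩ A ∪ Aᶜ := by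
      ext ω
      by_cases hω : ω ∈ A
      · simp [hω]
      · refine iff_of_true ?_ (Or.inr hω)
        simp only [Set.mem_ofPred_eq, if_neg hω]
        exact (min_le_left _ _).trans (WithTop.coe_le_coe.2 hsi)
    rw [h]
    exact ((((isStoppingTime_const 𝓕 t).min hτ) i).inter (𝓕.mono hsi _ hA)).union
      (𝓕.mono hsi _ hA).compl

/-- A stopped càdlàg martingale is a martingale. -/
lemma martingale_stoppedProcess [IsProbabilityMeasure P] (hc : IsCadlag X)
    (hX : Martingale X 𝓕 P) (hτ : IsStoppingTime 𝓕 τ) : Martingale (stoppedProcess X τ) 𝓕 P := by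
  classical
  have had := stronglyAdapted_stoppedProcess hc hX.stronglyAdapted hτ
  have hint := fun t => (integrable_integral_stoppedProcess hc hX hτ t).1
  refine ⟨had, fun s t hst => ?_⟩
  refine (ae_eq_condExp_of_forall_setIntegral_eq (𝓕.le s) (hint t)
    (fun _ _ _ => (hint s).integrableOn) (fun A hA _ => ?_)
    (had s).aestronglyMeasurable).symm
  have hA' := 𝓕.le s _ hA
  have hρ := isStoppingTime_switch hτ hst hA
  set ρ : Ω → WithTop ℝ≥0 :=
    fun ω => if ω ∈ A then min (t : WithTop ℝ≥0) (τ ω) else min (s : WithTop ℝ≥0) (τ ω) with hρd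
  have h1 := (integrable_integral_stoppedProcess hc hX hρ t)
  have h2 := (integrable_integral_stoppedProcess hc hX hτ s).2
  have h3 : ∫ ω, X s ω ∂P = ∫ ω, X t ω ∂P := by
    simpa using hX.setIntegral_eq hst MeasurableSet.univ
  have h4 : ∫ ω, stoppedProcess X ρ t ω ∂P = ∫ ω, stoppedProcess X τ s ω ∂P := by
    rw [h1.2, h2, h3]
  rw [← integral_add_compl hA' h1.1, ← integral_add_compl hA' (hint s)] at h4
  have e1 : ∫ ω in A, stoppedProcess X ρ t ω ∂P = ∫ ω in A, stoppedProcess X τ t ω ∂P := by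
    refine setIntegral_congr_fun hA' fun ω hω => ?_
    simp only [stoppedProcess, hρd, if_pos hω, inf_left_idem]
  have e2 : ∫ ω in Aᶜ, stoppedProcess X ρ t ω ∂P = ∫ ω in Aᶜ, stoppedProcess X τ s ω ∂P := by
    refine setIntegral_congr_fun hA'.compl fun ω hω => ?_
    have h5 : min (t : WithTop ℝ≥0) (min (s : WithTop ℝ≥0) (τ ω)) = min (s : WithTop ℝ≥0) (τ ω) :=
      min_eq_right ((min_le_left _ _).trans (WithTop.coe_le_coe.2 hst))
    simp only [stoppedProcess, hρd, if_neg hω, h5]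
  rw [e1, e2] at h4
  linarith

lemma minTime_of_le {t : ℝ≥0} {ω : Ω} (h : (t : WithTop ℝ≥0) ≤ τ ω) : minTime τ t ω = t := by
  rw [← WithTop.coe_inj, coe_minTime, min_eq_left h]

/-! ### Limits of martingales and uniform integrability. -/

/-- A limit of martingales which are dominated at each time is a martingale. -/
lemma martingale_of_tendsto [IsFiniteMeasure P] {U : ℕ → ℝ≥0 → Ω → ℝ} {Z : ℝ≥0 → Ω → ℝ}
    (hU : ∀ k, Martingale (U k) 𝓕 P) (hX : StronglyAdapted 𝓕 X)
    (hZ : ∀ t, Integrable (Z t) P) (hle : ∀ k t, ∀ᵐ ω ∂P, ‖U k t ω‖ ≤ Z t ω)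
    (hlim : ∀ t, ∀ᵐ ω ∂P, Tendsto (fun k => U k t ω) atTop (𝓝 (X t ω))) :
    Martingale X 𝓕 P := by
  refine ⟨hX, fun s t hst => ?_⟩
  have hint : Integrable (X s) P := by
    refine (hZ s).mono' ((hX s).mono (𝓕.le s)).aestronglyMeasurable ?_
    filter_upwards [hlim s, ae_all_iff.2 fun k => hle k s] with ω h1 h2
    exact le_of_tendsto' h1.norm h2
  have h := tendsto_condExp_unique (m := 𝓕 s) (fun k => U k t) (fun k => U k s) (X t) (X s)
    (fun k => (hU k).integrable t) (fun k => (hU k).integrable s) (hlim t) (hlim s)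
    (Z t) (hZ t) (Z s) (hZ s) (fun k => hle k t) (fun k => hle k s) fun k => by
      rw [condExp_of_stronglyMeasurable (𝓕.le s) ((hU k).stronglyAdapted s)
        ((hU k).integrable s)]
      exact (hU k).condExp_ae_eq hst
  rwa [condExp_of_stronglyMeasurable (𝓕.le s) (hX s) hint] at h

/-- The slack `ε` is essential: the maximal variable of `M^σ` is not integrable, so domination is
available only up to a small error. -/
lemma uniformIntegrable_of_setLIntegral_le {ι : Type*} {V : ι → Ω → ℝ}
    (hV : ∀ i, AEStronglyMeasurable (V i) P)
    (h : ∀ ε : ℝ≥0∞, ε ≠ 0 → ∃ Z : Ω → ℝ≥0∞, ∫⁻ ω, Z ω ∂P ≠ ∞ ∧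
      ∀ i s, MeasurableSet s → ∫⁻ ω in s, ‖V i ω‖ₑ ∂P ≤ ∫⁻ ω in s, Z ω ∂P + ε) :
    UniformIntegrable V 1 P := by
  refine ⟨hV, fun ε hε => ?_, ?_⟩
  · have hε2 : ENNReal.ofReal (ε / 2) ≠ 0 := by simp [hε]
    obtain ⟨Z, hZ, hle⟩ := h _ hε2
    obtain ⟨δ, hδ, hlt⟩ := exists_pos_setLIntegral_lt_of_measure_lt hZ hε2
    obtain ⟨δ', hδ', hδδ⟩ : ∃ δ' : ℝ, 0 < δ' ∧ ENNReal.ofReal δ' < δ := by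
      obtain ⟨r, hr0, hr⟩ := ENNReal.lt_iff_exists_nnreal_btwn.1 hδ
      exact ⟨r, by exact_mod_cast hr0, by simpa using hr⟩
    refine ⟨δ', hδ', fun i s hs hsδ => ?_⟩
    rw [eLpNorm_one_eq_lintegral_enorm]
    simp only [enorm_indicator_eq_indicator_enorm]
    rw [lintegral_indicator hs]
    calc ∫⁻ ω in s, ‖V i ω‖ₑ ∂P ≤ ∫⁻ ω in s, Z ω ∂P + ENNReal.ofReal (ε / 2) := hle i s hs
      _ ≤ ENNReal.ofReal (ε / 2) + ENNReal.ofReal (ε / 2) := by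
        gcongr
        exact (hlt s (hsδ.trans_lt hδδ)).le
      _ = ENNReal.ofReal ε := by
        rw [← ENNReal.ofReal_add (by positivity) (by positivity), add_halves]
  · obtain ⟨Z, hZ, hle⟩ := h 1 one_ne_zero
    refine ⟨(∫⁻ ω, Z ω ∂P + 1).toNNReal, fun i => ?_⟩
    rw [ENNReal.coe_toNNReal (by simp [hZ]), eLpNorm_one_eq_lintegral_enorm]
    simpa using hle i Set.univ MeasurableSet.univ

/-! ### The maximal variable and local martingales. -/

lemma supAbs_eq_iSup_denseSeq (hX : IsCadlag X) (ω : Ω) :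
    supAbs X ω = ⨆ n, ‖X (TopologicalSpace.denseSeq ℝ≥0 n) ω‖ₑ := by
  refine le_antisymm (iSup_le fun t => le_of_forall_lt fun c hc => ?_)
    (iSup_le fun n => le_iSup (fun t => ‖X t ω‖ₑ) _)
  have hU : IsOpen {x : ℝ | c < ‖x‖ₑ} := isOpen_lt continuous_const continuous_enorm
  obtain ⟨n, -, hn⟩ := exists_denseSeq_between (hX ω t).1 hU hc (lt_add_one t)
  exact hn.trans_le (le_iSup (fun n => ‖X (TopologicalSpace.denseSeq ℝ≥0 n) ω‖ₑ) n)

lemma measurable_supAbs (hX : IsCadlag X) (had : StronglyAdapted 𝓕 X) :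
    Measurable (supAbs X) := by
  have h : supAbs X = fun ω => ⨆ n, ‖X (TopologicalSpace.denseSeq ℝ≥0 n) ω‖ₑ :=
    funext (supAbs_eq_iSup_denseSeq hX)
  rw [h]
  exact Measurable.iSup fun n => ((had _).mono (𝓕.le _)).measurable.enorm

lemma eventually_stoppedProcess_eq {τ : ℕ → Ω → WithTop ℝ≥0} {ω : Ω}
    (hτ : Tendsto (τ · ω) atTop (𝓝 ⊤)) (t : ℝ≥0) :
    ∀ᶠ k in atTop, stoppedProcess X (τ k) t ω = X t ω := by
  filter_upwards [hτ.eventually (lt_mem_nhds (WithTop.coe_lt_top t))] with k hk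
  rw [stoppedProcess_apply, minTime_of_le hk.le]

/-- A local martingale with integrable maximal variable is a uniformly integrable martingale. -/
lemma IsLocalMartingale.isUIMartingale [IsProbabilityMeasure P] (hM : IsLocalMartingale M 𝓕 P)
    (hsup : ∫⁻ ω, supAbs M ω ∂P ≠ ∞) : IsUIMartingale M 𝓕 P := by
  have hmeas := measurable_supAbs hM.cadlag hM.adapted
  have hfin := ae_lt_top hmeas hsup
  obtain ⟨τ, hτ, hUI⟩ := hM.localized
  refine ⟨hM.cadlag, ?_, ?_⟩
  · refine martingale_of_tendsto (fun k => (hUI k).martingale) hM.adapted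
      (Z := fun _ ω => (supAbs M ω).toReal)
      (fun _ => integrable_toReal_of_lintegral_ne_top hmeas.aemeasurable hsup) ?_ ?_
    · intro k t
      filter_upwards [hfin] with ω hω
      rw [← toReal_enorm]
      exact ENNReal.toReal_mono hω.ne (le_iSup (fun t => ‖M t ω‖ₑ) _)
    · intro t
      filter_upwards [hτ.tendsto_top] with ω hω
      exact tendsto_const_nhds.congr' ((eventually_stoppedProcess_eq hω t).mono fun k hk => hk.symm)
  · refine uniformIntegrable_of_setLIntegral_le
      (fun t => ((hM.adapted t).mono (𝓕.le t)).aestronglyMeasurable)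
      fun ε _ => ⟨supAbs M, hsup, fun t s _ => ?_⟩
    exact (lintegral_mono fun ω => le_iSup (fun t => ‖M t ω‖ₑ) t).trans le_self_add

lemma stoppedProcess_zero (X : ℝ≥0 → Ω → ℝ) (τ : Ω → WithTop ℝ≥0) :
    stoppedProcess X τ 0 = X 0 := by
  ext ω
  rw [stoppedProcess_apply, minTime_zero]

lemma IsLocalMartingale.integrable_zero (hM : IsLocalMartingale M 𝓕 P) : Integrable (M 0) P := by
  obtain ⟨τ, -, hUI⟩ := hM.localized
  have h := (hUI 0).martingale.integrable 0
  rwa [stoppedProcess_zero] at h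

lemma setLIntegral_enorm_eq_zero_time [IsFiniteMeasure P] (hX : Martingale X 𝓕 P)
    (hnn : ∀ᵐ ω ∂P, ∀ t, 0 ≤ X t ω) {A : Set Ω} (hA : MeasurableSet[𝓕 0] A) (t : ℝ≥0) :
    ∫⁻ ω in A, ‖X t ω‖ₑ ∂P = ∫⁻ ω in A, ‖X 0 ω‖ₑ ∂P := by
  have h : ∀ s, ∫⁻ ω in A, ‖X s ω‖ₑ ∂P = ENNReal.ofReal (∫ ω in A, X s ω ∂P) := by
    intro s
    rw [← ofReal_integral_norm_eq_lintegral_enorm (hX.integrable s).integrableOn]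
    congr 1
    refine setIntegral_congr_ae (𝓕.le 0 _ hA) ?_
    filter_upwards [hnn] with ω hω _
    exact Real.norm_of_nonneg (hω s)
  rw [h, h, hX.setIntegral_eq zero_le hA]

/-- Nonnegative local martingales, stopped at an arbitrary time, are supermartingales. -/
lemma setLIntegral_stoppedProcess_le [IsProbabilityMeasure P] (hM : IsLocalMartingale M 𝓕 P)
    (hnn : ∀ᵐ ω ∂P, ∀ t, 0 ≤ M t ω) (hσ : IsStoppingTime 𝓕 σ) {A : Set Ω}
    (hA : MeasurableSet[𝓕 0] A) (t : ℝ≥0) :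
    ∫⁻ ω in A, ‖(stoppedProcess M σ t ω)‖ₑ ∂P ≤ ∫⁻ ω in A, ‖M 0 ω‖ₑ ∂P := by
  obtain ⟨τ, hτ, hUI⟩ := hM.localized
  have hmart : ∀ k, Martingale (stoppedProcess (stoppedProcess M (τ k)) σ) 𝓕 P := fun k =>
    martingale_stoppedProcess (hUI k).cadlag (hUI k).martingale hσ
  have heq : ∀ᵐ ω ∂(P.restrict A), ‖(stoppedProcess M σ t ω)‖ₑ =
      liminf (fun k => ‖(stoppedProcess (stoppedProcess M (τ k)) σ t ω)‖ₑ) atTop := by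
    filter_upwards [ae_restrict_of_ae hτ.tendsto_top] with ω hω
    refine (Tendsto.liminf_eq (tendsto_const_nhds.congr' ?_)).symm
    filter_upwards [eventually_stoppedProcess_eq (X := M) hω (minTime σ t ω)] with k hk
    rw [stoppedProcess_apply _ σ, stoppedProcess_apply _ σ, hk]
  rw [lintegral_congr_ae heq]
  -- Fatou along the localizing sequence; each doubly stopped process is a martingale started at `M
  -- 0`, so the bound does not depend on `k`.
  refine (lintegral_liminf_le fun k =>
    (((hmart k).stronglyAdapted t).mono (𝓕.le t)).measurable.enorm).trans ?_
  refine (liminf_congr (Eventually.of_forall fun k => ?_)).trans_le (liminf_const _).le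
  rw [setLIntegral_enorm_eq_zero_time (hmart k) (hnn.mono fun ω hω s => hω _) hA t]
  simp only [stoppedProcess_zero]

/-! ### Stopping at the first exceedance of a random level. -/

lemma natCast_lt_enorm_iff (n : ℕ) (x : ℝ) : (n : ℝ≥0∞) < ‖x‖ₑ ↔ (n : ℝ) < |x| := by
  rw [Real.enorm_eq_ofReal_abs, ← ENNReal.ofReal_natCast, ENNReal.ofReal_lt_ofReal_iff_of_nonneg
    (Nat.cast_nonneg n)]

lemma enorm_le_of_lt_firstExceed {ω : Ω} {t : ℝ≥0} (h : t < firstExceed M Y ω) :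
    ‖M t ω‖ₑ ≤ Y ω := by
  have h1 := notMem_of_lt_hittingAfter h zero_le
  exact not_lt.1 fun h2 => h1 ((natCast_lt_enorm_iff _ _).1 h2)

/-- If `|M_s| < Y`, right-continuity would keep the path below `Y` for a while after `s`. Equality
can occur, since the infimum need not be attained. -/
lemma le_enorm_of_firstExceed_eq (hM : IsCadlag M) {ω : Ω} {s : ℝ≥0}
    (h : firstExceed M Y ω = s) : (Y ω : ℝ≥0∞) ≤ ‖M s ω‖ₑ := by
  by_contra! hlt
  have hU : {x : ℝ | ‖x‖ₑ < Y ω} ∈ 𝓝 (M s ω) :=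
    (isOpen_lt continuous_enorm continuous_const).mem_nhds hlt
  obtain ⟨u, hu, hsub⟩ := (mem_nhdsGE_iff_exists_Ico_subset' (lt_add_one s)).1
    ((hM ω s).1.eventually hU)
  have h1 : firstExceed M Y ω < u := h ▸ WithTop.coe_lt_coe.2 hu
  obtain ⟨j, hj, hjM⟩ := hittingAfter_lt_iff.1 h1
  have h2 : s ≤ j := by
    rw [← WithTop.coe_le_coe, ← h]
    exact hittingAfter_le_of_mem zero_le hjM
  exact lt_asymm ((natCast_lt_enorm_iff _ _).2 hjM) (hsub ⟨h2, hj.2⟩)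

/-- The exceedance set is open, so dense times detect `σ < i`; right-continuity of the filtration
passes from `<` to `≤`. -/
lemma isStoppingTime_firstExceed [𝓕.IsRightContinuous] (hM : IsCadlag M)
    (had : StronglyAdapted 𝓕 M) (hY : Measurable[𝓕 0] Y) :
    IsStoppingTime 𝓕 (firstExceed M Y) := by
  refine isStoppingTime_of_measurableSet_lt_of_isRightContinuous fun i => ?_
  have h : {ω | firstExceed M Y ω < i} = ⋃ n, ⋃ (_ : TopologicalSpace.denseSeq ℝ≥0 n < i),
      {ω | (Y ω : ℝ) < |M (TopologicalSpace.denseSeq ℝ≥0 n) ω|} := by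
    ext ω
    simp only [Set.mem_ofPred_eq, Set.mem_iUnion, exists_prop]
    refine hittingAfter_lt_iff.trans ⟨?_, ?_⟩
    · rintro ⟨j, hj, hjM⟩
      exact exists_denseSeq_between (hM ω j).1 (U := {x : ℝ | (Y ω : ℝ) < |x|})
        (isOpen_lt continuous_const continuous_abs) hjM hj.2
    · rintro ⟨n, hn, hnM⟩
      exact ⟨_, ⟨zero_le, hn⟩, hnM⟩
  rw [h]
  refine MeasurableSet.iUnion fun n => MeasurableSet.iUnion fun hn => ?_
  refine measurableSet_lt (measurable_from_top.comp (hY.mono (𝓕.mono zero_le) le_rfl)) ?_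
  exact (continuous_abs.measurable).comp ((had _).mono (𝓕.mono hn.le)).measurable

lemma martingale_indicator [IsFiniteMeasure P] (hX : Martingale X 𝓕 P) {A : Set Ω}
    (hA : MeasurableSet[𝓕 0] A) : Martingale (fun t => A.indicator (X t)) 𝓕 P := by
  refine ⟨fun t => (hX.stronglyAdapted t).indicator (𝓕.mono zero_le _ hA), fun s t hst => ?_⟩
  refine (condExp_indicator (hX.integrable t) (𝓕.mono zero_le _ hA)).trans ?_
  exact (hX.condExp_ae_eq hst).indicator

/-- The limit inferior along the integers of `|M^σ|`, which is `|M_σ|` on `{σ < ∞}`. -/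
noncomputable def terminalAbs (X : ℝ≥0 → Ω → ℝ) (ω : Ω) : ℝ≥0∞ :=
  liminf (fun n : ℕ => ‖X n ω‖ₑ) atTop

lemma terminalAbs_of_eq_coe {ω : Ω} {s : ℝ≥0} (h : σ ω = s) :
    terminalAbs (stoppedProcess M σ) ω = ‖M s ω‖ₑ := by
  refine Tendsto.liminf_eq (tendsto_const_nhds.congr' ?_)
  filter_upwards [eventually_ge_atTop ⌈s⌉₊] with n hn
  rw [stoppedProcess_apply, minTime_of_eq_coe h, min_eq_right (Nat.ceil_le.1 hn)]

lemma enorm_le_add_terminalAbs {ω : Ω} {r : ℝ≥0} (h : r ≤ firstExceed M Y ω) :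
    ‖M r ω‖ₑ ≤ Y ω + terminalAbs (stoppedProcess M (firstExceed M Y)) ω := by
  rcases h.lt_or_eq with h | h
  · exact (enorm_le_of_lt_firstExceed h).trans le_self_add
  · rw [terminalAbs_of_eq_coe h.symm]
    exact le_add_self

lemma coe_minTime_le (t : ℝ≥0) (ω : Ω) :
    (minTime σ t ω : WithTop ℝ≥0) ≤ σ ω := by
  rw [coe_minTime]
  exact min_le_right _ _

/-- A nonnegative local martingale stopped when it exceeds an `𝓕 0`-measurable level is a
uniformly integrable martingale. -/
lemma isUIMartingale_stoppedProcess_firstExceed [IsProbabilityMeasure P] [𝓕.IsRightContinuous]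
    (hM : IsLocalMartingale M 𝓕 P) (hnn : ∀ᵐ ω ∂P, ∀ t, 0 ≤ M t ω) (hY : Measurable[𝓕 0] Y) :
    IsUIMartingale (stoppedProcess M (firstExceed M Y)) 𝓕 P := by
  have hσ := isStoppingTime_firstExceed hM.cadlag hM.adapted hY
  set σ := firstExceed M Y
  have hc : IsCadlag (stoppedProcess M σ) := hM.cadlag.stoppedProcess σ
  have had := stronglyAdapted_stoppedProcess hM.cadlag hM.adapted hσ
  have hmeas := fun t => ((had t).mono (𝓕.le t)).measurable
  have h0 : ∫⁻ ω, ‖M 0 ω‖ₑ ∂P ≠ ∞ := hM.integrable_zero.2.ne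
  have hA : ∀ N : ℕ, MeasurableSet[𝓕 0] {ω | Y ω ≤ N} := fun N => hY measurableSet_Iic
  set V := terminalAbs (stoppedProcess M σ)
  have hVm : Measurable V := Measurable.liminf fun n : ℕ => (hmeas n).enorm
  -- Fatou along integer times and the supermartingale bound give `E V ≤ E |M_0|`.
  have hVi : ∫⁻ ω, V ω ∂P ≠ ∞ := by
    refine ne_top_of_le_ne_top h0 ((lintegral_liminf_le fun n : ℕ => (hmeas n).enorm).trans ?_)
    refine (liminf_le_liminf (Eventually.of_forall fun n => ?_)).trans (liminf_const _).le
    simpa using setLIntegral_stoppedProcess_le hM hnn hσ MeasurableSet.univ (n : ℝ≥0)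
  have hZi : ∀ N : ℕ, ∫⁻ ω, ((N : ℝ≥0∞) + V ω) ∂P ≠ ∞ := fun N => by
    rw [lintegral_add_left measurable_const]
    simp [hVi]
  have hZm : ∀ N : ℕ, Measurable fun ω => (N : ℝ≥0∞) + V ω := fun N => hVm.const_add _
  have hbound : ∀ (N : ℕ) ω, Y ω ≤ N → ∀ r : ℝ≥0, (r : WithTop ℝ≥0) ≤ σ ω →
      ‖M r ω‖ₑ ≤ N + V ω := fun N ω hω r hr =>
    (enorm_le_add_terminalAbs hr).trans (by gcongr)
  have hint : ∀ t, Integrable (stoppedProcess M σ t) P := fun t => by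
    refine ⟨(hmeas t).aestronglyMeasurable, lt_of_le_of_lt ?_ h0.lt_top⟩
    simpa using setLIntegral_stoppedProcess_le hM hnn hσ MeasurableSet.univ t
  -- On `{Y ≤ N}` all the localized processes are dominated by `N + V`, so localization can be
  -- removed there.
  have hmartN : ∀ N : ℕ,
      Martingale (fun t => {ω | Y ω ≤ N}.indicator (stoppedProcess M σ t)) 𝓕 P := by
    intro N
    obtain ⟨τ, hτ, hUI⟩ := hM.localized
    refine martingale_of_tendsto
      (U := fun k t => {ω | Y ω ≤ N}.indicator (stoppedProcess (stoppedProcess M (τ k)) σ t))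
      (Z := fun _ ω => ((N : ℝ≥0∞) + V ω).toReal)
      (fun k => martingale_indicator
        (martingale_stoppedProcess (hUI k).cadlag (hUI k).martingale hσ) (hA N))
      (fun t => (had t).indicator (𝓕.mono zero_le _ (hA N)))
      (fun _ => integrable_toReal_of_lintegral_ne_top (hZm N).aemeasurable (hZi N))
      (fun k t => ?_) (fun t => ?_)
    · filter_upwards [ae_lt_top (hZm N) (hZi N)] with ω hω
      by_cases hωA : Y ω ≤ N
      · rw [Set.indicator_of_mem (by exact hωA), ← toReal_enorm]
        refine ENNReal.toReal_mono hω.ne (hbound N ω hωA _ ?_)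
        exact (WithTop.coe_le_coe.2 (minTime_le _ _ _)).trans (coe_minTime_le t ω)
      · rw [Set.indicator_of_notMem (by exact hωA), norm_zero]
        exact ENNReal.toReal_nonneg
    · filter_upwards [hτ.tendsto_top] with ω hω
      refine tendsto_const_nhds.congr' ?_
      filter_upwards [eventually_stoppedProcess_eq (X := M) hω (minTime σ t ω)] with k hk
      by_cases hωA : Y ω ≤ N
      · rw [Set.indicator_of_mem (by exact hωA), Set.indicator_of_mem (by exact hωA),
          stoppedProcess_apply _ σ, stoppedProcess_apply _ σ, hk]
      · rw [Set.indicator_of_notMem (by exact hωA), Set.indicator_of_notMem (by exact hωA)]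
  refine ⟨hc, ?_, ?_⟩
  -- Now `N → ∞`, dominated at each fixed time by `|M^σ_t|` itself.
  · refine martingale_of_tendsto hmartN had (Z := fun t ω => ‖(stoppedProcess M σ t ω)‖)
      (fun t => (hint t).norm) (fun N t => ae_of_all _ fun ω => norm_indicator_le_norm_self _ _)
      fun t => ae_of_all _ fun ω => ?_
    refine tendsto_const_nhds.congr' ?_
    filter_upwards [eventually_ge_atTop (Y ω)] with N hN
    rw [Set.indicator_of_mem (by exact hN)]
  · refine uniformIntegrable_of_setLIntegral_le (fun t => (hmeas t).aestronglyMeasurable)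
      fun ε hε => ?_
    have hlim : Tendsto (P ∘ fun N : ℕ => {ω | Y ω ≤ N}ᶜ) atTop (𝓝 0) := by
      have h := tendsto_measure_iInter_atTop (μ := P) (s := fun N : ℕ => {ω | Y ω ≤ N}ᶜ)
        (fun N => (𝓕.le 0 _ (hA N)).compl.nullMeasurableSet)
        (fun a b hab => Set.compl_subset_compl.2 fun ω (hω : Y ω ≤ a) => hω.trans hab)
        ⟨0, measure_ne_top _ _⟩
      have he : ⋂ N : ℕ, {ω | Y ω ≤ N}ᶜ = ∅ :=
        Set.eq_empty_of_forall_notMem fun ω hω => Set.mem_iInter.1 hω (Y ω) (le_refl (Y ω))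
      rwa [he, measure_empty] at h
    -- `N` makes `E(|M_0|; Y > N) < ε`; this bounds the part of `M^σ_t` off `{Y ≤ N}` for all `t` at
    -- once.
    obtain ⟨N, hN⟩ := ((tendsto_setLIntegral_zero h0 hlim).eventually
      (gt_mem_nhds (pos_iff_ne_zero.2 hε))).exists
    refine ⟨fun ω => N + V ω, hZi N, fun t s hs => ?_⟩
    have hAN := 𝓕.le 0 _ (hA N)
    rw [← lintegral_inter_add_sdiff _ s hAN]
    refine add_le_add ?_ ?_
    · refine (setLIntegral_mono (hZm N) fun ω hω => ?_).trans
        (lintegral_mono_set Set.inter_subset_left)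
      exact hbound N ω hω.2 _ (coe_minTime_le t ω)
    · refine (lintegral_mono_set fun ω hω => hω.2).trans (le_trans ?_ hN.le)
      exact setLIntegral_stoppedProcess_le hM hnn hσ (hA N).compl t

/-! ### Lower bounds for the maximal variable and counting of levels. -/

/-- If `σ = ∞` nothing is stopped; otherwise `|M_σ| ≥ Y`. -/
lemma min_le_supAbs_stoppedProcess (hM : IsCadlag M) (ω : Ω) :
    min (supAbs M ω) (Y ω) ≤ supAbs (stoppedProcess M (firstExceed M Y)) ω := by
  obtain h | ⟨s, hs⟩ : firstExceed M Y ω = ⊤ ∨ ∃ s : ℝ≥0, firstExceed M Y ω = s := by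
    cases h : firstExceed M Y ω with
    | top => exact Or.inl rfl
    | coe s => exact Or.inr ⟨s, rfl⟩
  · refine (min_le_left _ _).trans (le_of_eq ?_)
    simp only [supAbs, stoppedProcess_apply, minTime_of_eq_top h]
  · refine (min_le_right _ _).trans ((le_enorm_of_firstExceed_eq hM hs).trans ?_)
    refine le_trans (le_of_eq ?_) (le_iSup _ s)
    rw [stoppedProcess_apply, minTime_of_eq_coe hs, min_self]

lemma card_filter_lt_le (n : ℕ) (x : ℝ≥0∞) :
    (((Finset.Icc 1 n).filter fun k : ℕ => (k : ℝ≥0∞) < x).card : ℝ≥0∞) ≤ x := by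
  classical
  rcases ((Finset.Icc 1 n).filter fun k : ℕ => (k : ℝ≥0∞) < x).eq_empty_or_nonempty with h | h
  · simp [h]
  · obtain ⟨k, hk, hmax⟩ := Finset.exists_max_image _ id h
    have hsub : ((Finset.Icc 1 n).filter fun k : ℕ => (k : ℝ≥0∞) < x) ⊆ Finset.Icc 1 k :=
      fun j hj => Finset.mem_Icc.2
        ⟨(Finset.mem_Icc.1 (Finset.mem_filter.1 hj).1).1, hmax j hj⟩
    have hcard := Finset.card_le_card hsub
    rw [Nat.card_Icc, Nat.add_sub_cancel] at hcard
    exact (Nat.cast_le.2 hcard).trans (Finset.mem_filter.1 hk).2.le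

/-- Level `0` is counted too: for finite `x` there are `⌈x⌉` natural numbers below `x`. -/
lemma le_tsum_indicator_lt (x : ℝ≥0∞) :
    x ≤ ∑' k : ℕ, {y : ℝ≥0∞ | (k : ℝ≥0∞) < y}.indicator 1 x := by
  refine le_of_forall_lt fun c hc => ?_
  lift c to ℝ≥0 using hc.ne_top
  have hk : ∀ k ∈ Finset.range (⌊c⌋₊ + 1),
      {y : ℝ≥0∞ | (k : ℝ≥0∞) < y}.indicator (1 : ℝ≥0∞ → ℝ≥0∞) x = 1 := fun k hk => by
    refine Set.indicator_of_mem (lt_of_le_of_lt ?_ hc) _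
    have h1 : (k : ℝ≥0) ≤ c :=
      (Nat.le_floor_iff zero_le).1 (Nat.lt_succ_iff.1 (Finset.mem_range.1 hk))
    exact_mod_cast h1
  refine lt_of_lt_of_le ?_ (ENNReal.sum_le_tsum (Finset.range (⌊c⌋₊ + 1)))
  rw [Finset.sum_congr rfl hk]
  have h2 := Nat.lt_floor_add_one c
  simp only [Finset.sum_const, Finset.card_range, nsmul_eq_mul, mul_one]
  exact_mod_cast h2

lemma lintegral_supAbs_le_tsum (hX : IsCadlag X) (had : StronglyAdapted 𝓕 X) :
    ∫⁻ ω, supAbs X ω ∂P ≤ ∑' k : ℕ, P {ω | (k : ℝ≥0∞) < supAbs X ω} := by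
  have hm := measurable_supAbs hX had
  have hS : ∀ k : ℕ, MeasurableSet {ω | (k : ℝ≥0∞) < supAbs X ω} := fun k =>
    measurableSet_lt measurable_const hm
  calc ∫⁻ ω, supAbs X ω ∂P
      ≤ ∫⁻ ω, ∑' k : ℕ, {ω | (k : ℝ≥0∞) < supAbs X ω}.indicator 1 ω ∂P :=
        lintegral_mono fun ω => le_tsum_indicator_lt (supAbs X ω)
    _ = ∑' k : ℕ, P {ω | (k : ℝ≥0∞) < supAbs X ω} := by
        rw [lintegral_tsum fun k => (measurable_one.indicator (hS k)).aemeasurable]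
        simp only [lintegral_indicator_one (hS _)]

/-! ### Growth of the tail sums and of `c_n`. -/

/-- The sum `∑_{k=1}^n P(sup_{t ≥ 0} |X_t| > k)`. -/
noncomputable def tailSum (X : ℝ≥0 → Ω → ℝ) (P : Measure Ω) (n : ℕ) : ℝ :=
  ∑ k ∈ Finset.Icc 1 n, P.real {ω | (k : ℝ≥0∞) < supAbs X ω}

lemma tailSeq_eq (X : ℝ≥0 → Ω → ℝ) (P : Measure Ω) (n : ℕ) :
    tailSeq X P n = Real.log (Real.exp 1 + tailSum X P n) := rfl

lemma monotone_tailSum : Monotone (tailSum X P) := fun _ _ h =>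
  Finset.sum_le_sum_of_subset_of_nonneg (Finset.Icc_subset_Icc_right h)
    fun _ _ _ => measureReal_nonneg

lemma tailSum_nonneg (n : ℕ) : 0 ≤ tailSum X P n :=
  Finset.sum_nonneg fun _ _ => measureReal_nonneg

lemma exp_tailSeq (n : ℕ) : Real.exp (tailSeq X P n) = Real.exp 1 + tailSum X P n := by
  rw [tailSeq_eq, Real.exp_log]
  have := tailSum_nonneg (X := X) (P := P) n
  positivity

lemma monotone_tailSeq : Monotone (tailSeq X P) := fun a b h => by
  rw [← Real.exp_le_exp, exp_tailSeq, exp_tailSeq]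
  gcongr
  exact monotone_tailSum h

lemma one_le_tailSeq (n : ℕ) : 1 ≤ tailSeq X P n := by
  rw [← Real.exp_le_exp, exp_tailSeq]
  exact le_add_of_nonneg_right (tailSum_nonneg n)

lemma one_lt_tailSeq [IsProbabilityMeasure P] (h : ∫⁻ ω, supAbs X ω ∂P = ∞) {n : ℕ}
    (hn : 1 ≤ n) : 1 < tailSeq X P n := by
  rw [← Real.exp_lt_exp, exp_tailSeq, lt_add_iff_pos_right]
  refine lt_of_lt_of_le ?_ (monotone_tailSum hn)
  rw [tailSum, Finset.Icc_self, Finset.sum_singleton]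
  -- If the first term vanished, `sup |X| ≤ 1` almost surely and its mean would be finite.
  refine lt_of_le_of_ne measureReal_nonneg fun h0 => ?_
  have h1 : P {ω | ((1 : ℕ) : ℝ≥0∞) < supAbs X ω} = 0 := (measureReal_eq_zero_iff).1 h0.symm
  have h2 : ∀ᵐ ω ∂P, supAbs X ω ≤ 1 := by
    filter_upwards [measure_eq_zero_iff_ae_notMem.1 h1] with ω hω
    simpa using hω
  have h3 := lintegral_mono_ae h2
  rw [h, lintegral_const, measure_univ, one_mul, top_le_iff] at h3
  exact ENNReal.one_ne_top h3

lemma sum_measure_eq_ofReal_tailSum [IsFiniteMeasure P] (n : ℕ) :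
    ∑ k ∈ Finset.Icc 1 n, P {ω | (k : ℝ≥0∞) < supAbs X ω} = ENNReal.ofReal (tailSum X P n) := by
  rw [tailSum, ENNReal.ofReal_sum_of_nonneg fun _ _ => measureReal_nonneg]
  exact Finset.sum_congr rfl fun k _ => (ofReal_measureReal).symm

lemma tendsto_tailSum [IsProbabilityMeasure P] (hX : IsCadlag X) (had : StronglyAdapted 𝓕 X)
    (h : ∫⁻ ω, supAbs X ω ∂P = ∞) : Tendsto (tailSum X P) atTop atTop := by
  refine tendsto_atTop_atTop_of_monotone monotone_tailSum fun B => ?_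
  by_contra! hB
  have hle : ∑' k : ℕ, P {ω | (k : ℝ≥0∞) < supAbs X ω} ≤ 1 + ENNReal.ofReal B := by
    refine ENNReal.tsum_le_of_sum_range_le fun n => ?_
    have hsub : Finset.range n ⊆ insert 0 (Finset.Icc 1 n) := fun k hk => by
      have := Finset.mem_range.1 hk
      rw [Finset.mem_insert, Finset.mem_Icc]
      omega
    refine (Finset.sum_le_sum_of_subset hsub).trans ?_
    rw [Finset.sum_insert (by simp), sum_measure_eq_ofReal_tailSum]
    exact add_le_add prob_le_one (ENNReal.ofReal_le_ofReal (hB n).le)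
  have h1 := (lintegral_supAbs_le_tsum (P := P) hX had).trans hle
  rw [h, top_le_iff] at h1
  exact (ENNReal.add_lt_top.2 ⟨ENNReal.one_lt_top, ENNReal.ofReal_lt_top⟩).ne h1

lemma tendsto_tailSeq (h : Tendsto (tailSum X P) atTop atTop) :
    Tendsto (tailSeq X P) atTop atTop :=
  Real.tendsto_log_atTop.comp (tendsto_atTop_add_const_left _ _ h)

/-- As `S_n = exp c_n - e`, the quotient is at least `exp c_n / c_n - e`, because `c_n ≥ 1`. -/
lemma tendsto_tailSum_div_tailSeq (h : Tendsto (tailSum X P) atTop atTop) :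
    Tendsto (fun n => tailSum X P n / tailSeq X P n) atTop atTop := by
  have h1 : Tendsto (fun x : ℝ => Real.exp x / x ^ 1) atTop atTop :=
    Real.tendsto_exp_div_pow_atTop 1
  have h2 := tendsto_atTop_add_const_right atTop (-Real.exp 1) (h1.comp (tendsto_tailSeq h))
  refine tendsto_atTop_mono (fun n => ?_) h2
  have hc := one_le_tailSeq (X := X) (P := P) n
  have hc0 : 0 < tailSeq X P n := zero_lt_one.trans_le hc
  rw [Function.comp_apply, pow_one, exp_tailSeq, add_div]
  have : Real.exp 1 / tailSeq X P n ≤ Real.exp 1 :=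
    div_le_self (Real.exp_pos 1).le hc
  linarith

/-! ### Independence and divergence of the stopped maximal variable. -/

/-- Independence concerns the product σ-algebra on paths, so the supremum is first rewritten over
countably many times. -/
lemma measure_inter_eq_mul_of_indepFun (hX : IsCadlag X)
    (hind : IndepFun (fun ω t => X t ω) Y P) (k : ℕ) :
    P ({ω | (k : ℝ≥0∞) < supAbs X ω} ∩ {ω | k < Y ω}) =
      P {ω | (k : ℝ≥0∞) < supAbs X ω} * P {ω | k < Y ω} := by
  have hS : MeasurableSet {f : ℝ≥0 → ℝ |
      (k : ℝ≥0∞) < ⨆ n, ‖f (TopologicalSpace.denseSeq ℝ≥0 n)‖ₑ} :=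
    measurableSet_lt measurable_const
      (Measurable.iSup fun n => (measurable_pi_apply _).enorm)
  have h := hind.measure_inter_preimage_eq_mul _ (Set.Ioi k) hS measurableSet_Ioi
  have he : {ω | (k : ℝ≥0∞) < supAbs X ω} = (fun ω t => X t ω) ⁻¹' {f : ℝ≥0 → ℝ |
      (k : ℝ≥0∞) < ⨆ n, ‖f (TopologicalSpace.denseSeq ℝ≥0 n)‖ₑ} := by
    ext ω
    simp only [Set.mem_preimage, Set.mem_ofPred_eq, supAbs_eq_iSup_denseSeq hX]
  rw [he]
  exact h

lemma lintegral_supAbs_stoppedProcess_eq_top [IsProbabilityMeasure P] (hX : IsCadlag X)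
    (had : StronglyAdapted 𝓕 X) (htop : ∫⁻ ω, supAbs X ω ∂P = ∞) (hYm : Measurable Y)
    (hind : IndepFun (fun ω t => X t ω) Y P)
    (hY : ∀ n : ℕ, 1 ≤ n → P.real {ω | n < Y ω} = 1 / tailSeq X P n) :
    ∫⁻ ω, supAbs (stoppedProcess X (firstExceed X Y)) ω ∂P = ∞ := by
  have hm := measurable_supAbs hX had
  have hS : ∀ k : ℕ, MeasurableSet ({ω | (k : ℝ≥0∞) < supAbs X ω} ∩ {ω | k < Y ω}) := fun k =>
    (measurableSet_lt measurable_const hm).inter (hYm measurableSet_Ioi)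
  have hlow : ∀ n : ℕ, ENNReal.ofReal (tailSum X P n / tailSeq X P n) ≤
      ∫⁻ ω, supAbs (stoppedProcess X (firstExceed X Y)) ω ∂P := fun n => by
    calc ENNReal.ofReal (tailSum X P n / tailSeq X P n)
        ≤ ∑ k ∈ Finset.Icc 1 n, P ({ω | (k : ℝ≥0∞) < supAbs X ω} ∩ {ω | k < Y ω}) := by
          rw [tailSum, Finset.sum_div, ENNReal.ofReal_sum_of_nonneg fun k _ =>
            div_nonneg measureReal_nonneg (zero_le_one.trans (one_le_tailSeq n))]
          refine Finset.sum_le_sum fun k hk => ?_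
          obtain ⟨hk1, hkn⟩ := Finset.mem_Icc.1 hk
          rw [measure_inter_eq_mul_of_indepFun hX hind, ← ofReal_measureReal,
            ← ofReal_measureReal (s := {ω | k < Y ω}), ← ENNReal.ofReal_mul measureReal_nonneg,
            hY k hk1, mul_one_div]
          refine ENNReal.ofReal_le_ofReal (div_le_div_of_nonneg_left measureReal_nonneg
            (zero_lt_one.trans_le (one_le_tailSeq k)) (monotone_tailSeq hkn))
      _ = ∫⁻ ω, ∑ k ∈ Finset.Icc 1 n,
            ({ω | (k : ℝ≥0∞) < supAbs X ω} ∩ {ω | k < Y ω}).indicator 1 ω ∂P := by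
          rw [lintegral_finsetSum _ fun k _ => measurable_one.indicator (hS k)]
          exact Finset.sum_congr rfl fun k _ => (lintegral_indicator_one (hS k)).symm
      _ ≤ ∫⁻ ω, supAbs (stoppedProcess X (firstExceed X Y)) ω ∂P := by
          -- The sum counts the levels `k ≤ n` below both `sup |X|` and `Y`, hence is at most their
          -- minimum.
          refine lintegral_mono fun ω => ?_
          refine le_trans ?_ (min_le_supAbs_stoppedProcess hX ω)
          refine le_trans (le_of_eq ?_) (card_filter_lt_le n _)
          rw [Finset.card_filter, Nat.cast_sum]
          refine Finset.sum_congr rfl fun k _ => ?_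
          simp [Set.indicator_apply]
  refine ENNReal.eq_top_of_forall_nnreal_le fun r => ?_
  obtain ⟨n, hn⟩ := ((tendsto_tailSum_div_tailSeq
    (tendsto_tailSum hX had htop)).eventually_ge_atTop (r : ℝ)).exists
  refine le_trans ?_ (hlow n)
  rw [← ENNReal.ofReal_coe_nnreal]
  exact ENNReal.ofReal_le_ofReal hn

end WeakTail

theorem mainTheorem4 {Ω : Type*} {m : MeasurableSpace Ω} (P : Measure Ω) [IsProbabilityMeasure P]
    (𝓕 : Filtration ℝ≥0 m) [𝓕.IsRightContinuous] (M : ℝ≥0 → Ω → ℝ)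
    (hM : WeakTail.IsLocalMartingale M 𝓕 P)
    (hM_nonneg : ∀ᵐ ω ∂P, ∀ t, 0 ≤ M t ω)
    (hM_not_ui : ¬ WeakTail.IsUIMartingale M 𝓕 P) :
    (∀ n, 1 ≤ n → 1 < WeakTail.tailSeq M P n) ∧
    Monotone (WeakTail.tailSeq M P) ∧
    Tendsto (WeakTail.tailSeq M P) atTop atTop ∧
    ∀ Y : Ω → ℕ, Measurable[𝓕 0] Y →
      IndepFun (fun ω t => M t ω) Y P →
      (∀ n : ℕ, 1 ≤ n → P.real {ω | n < Y ω} = 1 / WeakTail.tailSeq M P n) →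
      IsStoppingTime 𝓕 (WeakTail.firstExceed M Y) ∧
      WeakTail.IsUIMartingale (stoppedProcess M (WeakTail.firstExceed M Y)) 𝓕 P ∧
      ¬ WeakTail.IsH1 (stoppedProcess M (WeakTail.firstExceed M Y)) 𝓕 P ∧
      ∫⁻ ω, WeakTail.supAbs (stoppedProcess M (WeakTail.firstExceed M Y)) ω ∂P = ∞ := by
  have htop : ∫⁻ ω, WeakTail.supAbs M ω ∂P = ∞ := by
    by_contra h
    exact hM_not_ui (hM.isUIMartingale h)
  refine ⟨fun n hn => WeakTail.one_lt_tailSeq htop hn, WeakTail.monotone_tailSeq,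
    WeakTail.tendsto_tailSeq (WeakTail.tendsto_tailSum hM.cadlag hM.adapted htop),
    fun Y hY hind hYP => ?_⟩
  have hsup := WeakTail.lintegral_supAbs_stoppedProcess_eq_top hM.cadlag hM.adapted htop
    (hY.mono (𝓕.le 0) le_rfl) hind hYP
  exact ⟨WeakTail.isStoppingTime_firstExceed hM.cadlag hM.adapted hY,
    WeakTail.isUIMartingale_stoppedProcess_firstExceed hM hM_nonneg hY,
    fun h => h.integrable_sup.ne hsup, hsup⟩
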